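/- **Theorem (Closed-form Euler matching at good primes).** Let $E_0: y^2=x^3+8x$ (the elliptic curve over $\mathbb{Q}$ with Cremona label 256b2). For a prime $p$ put $a_p=p+1-\#E_0(\mathbb{F}_p)$, where $\#E_0(\mathbb{F}_p)$ is the number of projective points of the reduced equation $y^2=x^3+8x$ over $\mathbb{F}_p$ (so $a_2=0$; these are the prime coefficients of $L(E_0,s)$, i.e. the Hecke eigenvalues of the weight-$2$ newform attached to $E_0$). Let $$A(z;\lambda)=z\,I_2-L_S-\lambda z^{-1/2}V,\qquad L_S=\begin{pmatrix}1&0\\0&-1\end{pmatrix},\quad V=\begin{pmatrix}1&1\\-1&1\end{pmatrix},\qquad R(z;\lambda)=A(z;\lambda)^{-1},$$ with the principal branch of $z^{-1/2}$ (with $\arg z=\pi$ on the negative axis). On the double cover $z=u^2$, $u\neq 0$, write $A_u(\lambda)=u^2I_2-L_S-\lambda u^{-1}V$, $R_u(\lambda)=A_u(\lambda)^{-1}$ and $$P(u;\lambda)=u^2\det A_u(\lambda)=u^6-u^2-2\lambda u^3+2\lambda^2,$$ so that $\{P=0\}$ is the affine spectral curve. A *basepoint* at $p$ is a pair $(u,\lambda)\in\mathbb{C}^2$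 with $u\ne0$, $A_u(\lambda)$ invertible, $\operatorname{tr}R_u(\lambda)=a_p$ and $\det R_u(\lambda)=p$; it is *real* if $u,\lambda\in\mathbb{R}$. Set $$\Delta_p=4p(p+1)-a_p^2,\qquad w_p^{\pm}=\frac{a_p\pm\sqrt{\Delta_p}}{2p},\qquad \lambda_p^{\pm}=(w_p^{\pm})^{3/2}-\frac{a_p}{2p}(w_p^{\pm})^{1/2}$$ (principal branch). Then: (a) $\Delta_p>0$ for every prime $p$. (b) For every prime $p$, $w_p^+>0$ and $w_p^-<0$. The real basepoints at $p$ are exactly $(\sqrt{w_p^+},\lambda_p^+)$ and $(-\sqrt{w_p^+},-\lambda_p^+)$. The basepoints with $u^2=w_p^-$ are exactly $\pm\bigl((w_p^-)^{1/2},\lambda_p^-\bigr)$, and they are not real. Every real basepoint lies off the spectral curve ($P\ne0$), and $P(\sqrt{w_p^+};\lambda_p^+)=P(-\sqrt{w_p^+};-\lambda_p^+)=w_p^+/p$. (c) For every prime $p\neq2$ the matrix $A(w_p^+;\lambda_p^+)$ is invertible and $$\det\bigl(I_2-p^{-s}R(w_p^{+};\lambda_p^{+})\bigr)=1-a_p\,p^{-s}+p^{1-2s}=L_p(E_0,s)^{-1},$$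 as an identity of polynomials in $p^{-s}$ and hence for all $s\in\mathbb{C}$, where $L_p(E_0,s)$ is the local Euler factor of $E_0$ at $p$. The same holds with $(w_p^-,\lambda_p^-)$ in place of $(w_p^+,\lambda_p^+)$. -/

import Mathlib

noncomputable section

open Polynomial

namespace EulerMatching

/-- The curve `E₀ : y² = x³ + 8x`, by its (globally minimal) integral Weierstrass equation. -/
def E0 : WeierstrassCurve ℤ := ⟨0, 0, 0, 8, 0⟩

/-- `a_p = p + 1 - #E₀(𝔽_p)`, where `#E₀(𝔽_p)` is the number of projective points of the reduced
equation: its affine solutions and the point at infinity. At the additive prime `2` the singular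
point is counted too, which gives `a_2 = 0`. -/
def a (p : ℕ) : ℤ :=
  (p : ℤ) + 1 - ((Nat.card {P : ZMod p × ZMod p //
    (E0.map (Int.castRingHom (ZMod p))).toAffine.Equation P.1 P.2} : ℤ) + 1)

/-- The polynomial `L_p(E₀, T)` with `L_p(E₀, s)⁻¹ = L_p(E₀, p⁻ˢ)`: Mathlib's local polynomial of
the curve `E₀` over the local field `ℚ_p`. -/
def localPoly (p : ℕ) [Fact p.Prime] : ℂ[X] :=
  ((E0.map (Int.castRingHom ℚ_[p])).localPolynomial ℤ_[p]).map (Int.castRingHom ℂ)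

/-- The local Euler factor `L_p(E₀, s)`. -/
def localLFactor (p : ℕ) [Fact p.Prime] (s : ℂ) : ℂ :=
  ((localPoly p).eval ((p : ℂ) ^ (-s)))⁻¹

def LS : Matrix (Fin 2) (Fin 2) ℂ := !![1, 0; 0, -1]

def V : Matrix (Fin 2) (Fin 2) ℂ := !![1, 1; -1, 1]

/-- The pencil `A(z; λ) = z - L_S - λ z^{-1/2} V`, with the principal branch of `z^{-1/2}`. -/
def pencil (z lam : ℂ) : Matrix (Fin 2) (Fin 2) ℂ :=
  z • (1 : Matrix (Fin 2) (Fin 2) ℂ) - LS - (lam * z ^ (-(1 / 2) : ℂ)) • V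

/-- The resolvent `R(z; λ) = A(z; λ)⁻¹`. -/
def resolvent (z lam : ℂ) : Matrix (Fin 2) (Fin 2) ℂ := (pencil z lam)⁻¹

/-- The pencil on the double cover `z = u²`, where `z^{1/2}` is read as `u`. -/
def pencilU (u lam : ℂ) : Matrix (Fin 2) (Fin 2) ℂ :=
  (u ^ 2) • (1 : Matrix (Fin 2) (Fin 2) ℂ) - LS - (lam * u⁻¹) • V

/-- The resolvent on the double cover `z = u²`. -/
def resolventU (u lam : ℂ) : Matrix (Fin 2) (Fin 2) ℂ := (pencilU u lam)⁻¹

/-- The polynomial `P(u; λ)`, whose zero locus is the affine spectral curve. -/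
def P (u lam : ℂ) : ℂ := u ^ 6 - u ^ 2 - 2 * lam * u ^ 3 + 2 * lam ^ 2

/-- `P(u; λ) = u² det A(u²; λ)`. -/
theorem P_eq (u lam : ℂ) (hu : u ≠ 0) : P u lam = u ^ 2 * (pencilU u lam).det := by
  simp [P, pencilU, LS, V, Matrix.det_fin_two]
  field_simp
  ring

/-- `Δ_p = 4p(p+1) - a_p²`. -/
def disc (p : ℕ) : ℝ := 4 * p * (p + 1) - (a p : ℝ) ^ 2

def wPlus (p : ℕ) : ℝ := ((a p : ℝ) + √(disc p)) / (2 * p)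

def wMinus (p : ℕ) : ℝ := ((a p : ℝ) - √(disc p)) / (2 * p)

/-- `w^{3/2} - (a_p / (2p)) w^{1/2}` on the principal branch; its values at `w_p^±` are `λ_p^±`. -/
def lam (p : ℕ) (w : ℂ) : ℂ :=
  w ^ (3 / 2 : ℂ) - (a p : ℂ) / (2 * p) * w ^ (1 / 2 : ℂ)

/-- `(u, l)` is a basepoint at `p`: a solution, with `u ≠ 0` and invertible pencil, of the matching
system `tr R = a_p`, `det R = p`. -/
def IsBasepoint (p : ℕ) (x : ℂ × ℂ) : Prop :=
  x.1 ≠ 0 ∧ IsUnit (pencilU x.1 x.2).det ∧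
    (resolventU x.1 x.2).trace = (a p : ℂ) ∧ (resolventU x.1 x.2).det = (p : ℂ)

/-- Both coordinates are real. -/
def IsRealPoint (x : ℂ × ℂ) : Prop := x.1.im = 0 ∧ x.2.im = 0

end EulerMatching

end

/-!
Write `a = a_p`. For a `2 × 2` matrix the matching system `tr A⁻¹ = a`, `det A⁻¹ = p` says
`tr A = a / p`, `det A = 1 / p`. For the pencil over `z = u²` the first equation is linear in `λ`
and gives `λ = u (u² - a / (2p))`; substituted into the second, it leaves a quadratic equation for
`z` with discriminant `4p(p + 1) - a²`. An affine Weierstrass equation has at most two solutions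
over each `x`, whence `|a| ≤ p`: the quadratic has one positive and one negative root, and the
real basepoints are those over the positive one. At a basepoint
`det (1 - T A⁻¹) = 1 - a T + p T²`.

For `p ≠ 2` the discriminant of `E₀` is a unit in `ℤ_p`. A change of variables `(u, r, s, t)`
between two integral Weierstrass equations with unit discriminants is itself integral: `u¹²` is a
unit, and `r`, `s`, `t` are successively roots of monic integral polynomials. Hence the reduction
of a minimal equation has as many points as the equation of `E₀` modulo `p`, and the trace in the
local Euler factor is `a`.
-/

namespace EulerMatching

open Polynomial WeierstrassCurve

section VariableChange

variable {R : Type*} [CommRing R]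

theorem isIntegral_of_pow_eq_sum {A : Type*} [CommRing A] [Algebra R A] {n : ℕ} {x : A}
    (c : Fin n → A) (hc : ∀ i, IsIntegral R (c i)) (hx : x ^ n = ∑ i, c i * x ^ (i : ℕ)) :
    IsIntegral R x := by
  lift c to Fin n → integralClosure R A using hc
  refine isIntegral_trans (A := integralClosure R A) x
    ⟨X ^ n - ∑ i : Fin n, C (c i) * X ^ (i : ℕ), monic_X_pow_sub (degree_sum_fin_lt _), ?_⟩
  simp only [eval₂_sub, eval₂_X_pow, eval₂_finsetSum, eval₂_mul, eval₂_C, hx]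
  exact sub_self _

theorem pow_mul_inv_pow_mul (u : Rˣ) (n : ℕ) (x : R) : (u : R) ^ n * ((↑u⁻¹ : R) ^ n * x) = x := by
  simpa only [← inv_pow, Units.val_pow_eq_pow_val] using (u ^ n).mul_inv_cancel_left x

theorem inv_pow_mul_pow_mul (u : Rˣ) (n : ℕ) (x : R) : (↑u⁻¹ : R) ^ n * ((u : R) ^ n * x) = x := by
  simpa only [← inv_pow, Units.val_pow_eq_pow_val] using (u ^ n).inv_mul_cancel_left x

variable {A : Type*} [CommRing A] [Algebra R A] {W W' : WeierstrassCurve R}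
  {C : VariableChange A}

theorem isIntegral_u_of_isUnit_Δ (hC : C • W.map (algebraMap R A) = W'.map (algebraMap R A))
    (hW' : IsUnit W'.Δ) : IsIntegral R (C.u : A) := by
  obtain ⟨d, hd⟩ := hW'
  refine .of_pow (n := 12) (by norm_num) ?_
  suffices (C.u : A) ^ 12 = algebraMap R A (W.Δ * ↑d⁻¹) from this ▸ isIntegral_algebraMap
  have hΔ : (W.map (algebraMap R A)).Δ = C.u ^ 12 * algebraMap R A d := by
    rw [hd, ← map_Δ, ← hC, variableChange_Δ, pow_mul_inv_pow_mul]
  rw [map_mul, ← map_Δ, hΔ, mul_assoc, ← map_mul, d.mul_inv, map_one, mul_one]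

theorem isIntegral_r_of_isIntegral_u
    (hC : C • W.map (algebraMap R A) = W'.map (algebraMap R A)) (hu : IsIntegral R (C.u : A)) :
    IsIntegral R C.r := by
  have hb₆ := congrArg (fun E ↦ (C.u : A) ^ 6 * E.b₆) hC
  have hb₈ := congrArg (fun E ↦ (C.u : A) ^ 8 * E.b₈) hC
  simp only [variableChange_b₆, variableChange_b₈, pow_mul_inv_pow_mul, map_b₂, map_b₄, map_b₆,
    map_b₈] at hb₆ hb₈
  refine isIntegral_of_pow_eq_sum (n := 4)
    ![algebraMap R A W.b₈ - C.u ^ 8 * algebraMap R A W'.b₈,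
      algebraMap R A (2 * W.b₆) + C.u ^ 6 * algebraMap R A W'.b₆, algebraMap R A W.b₄, 0] ?_ ?_
  · simp only [Fin.forall_fin_succ, Fin.forall_fin_zero]
    exact ⟨isIntegral_algebraMap.sub ((hu.pow 8).mul isIntegral_algebraMap),
      isIntegral_algebraMap.add ((hu.pow 6).mul isIntegral_algebraMap),
      isIntegral_algebraMap, isIntegral_zero, trivial⟩
  · simp only [Fin.sum_univ_four, Matrix.cons_val, Fin.coe_ofNat_eq_mod, Nat.reduceMod, map_mul,
      map_ofNat]
    -- The leading coefficients `4` and `3` of the `b₆` and `b₈` relations in `r` combine to `1`, so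
    -- that neither `2` nor `3` has to be invertible.
    linear_combination C.r * hb₆ - hb₈

theorem isIntegral_s_of_isIntegral_u
    (hC : C • W.map (algebraMap R A) = W'.map (algebraMap R A)) (hu : IsIntegral R (C.u : A)) :
    IsIntegral R C.s := by
  have ha₂ := congrArg (fun E ↦ (C.u : A) ^ 2 * E.a₂) hC
  simp only [variableChange_a₂, pow_mul_inv_pow_mul, map_a₁, map_a₂] at ha₂
  have hr := isIntegral_r_of_isIntegral_u hC hu
  refine isIntegral_of_pow_eq_sum (n := 2)
    ![algebraMap R A W.a₂ + 3 • C.r - C.u ^ 2 * algebraMap R A W'.a₂, -algebraMap R A W.a₁] ?_ ?_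
  · simp only [Fin.forall_fin_succ, Fin.forall_fin_zero]
    exact ⟨(isIntegral_algebraMap.add (hr.smul 3)).sub ((hu.pow 2).mul isIntegral_algebraMap),
      isIntegral_algebraMap.neg, trivial⟩
  · simp only [Fin.sum_univ_two, Matrix.cons_val, Fin.coe_ofNat_eq_mod, Nat.reduceMod, nsmul_eq_mul]
    linear_combination -ha₂

theorem isIntegral_t_of_isIntegral_u
    (hC : C • W.map (algebraMap R A) = W'.map (algebraMap R A)) (hu : IsIntegral R (C.u : A)) :
    IsIntegral R C.t := by
  have ha₆ := congrArg (fun E ↦ (C.u : A) ^ 6 * E.a₆) hC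
  simp only [variableChange_a₆, pow_mul_inv_pow_mul, map_a₁, map_a₂, map_a₃, map_a₄, map_a₆] at ha₆
  have hr := isIntegral_r_of_isIntegral_u hC hu
  refine isIntegral_of_pow_eq_sum (n := 2)
    ![algebraMap R A W.a₆ + C.r * algebraMap R A W.a₄ + C.r ^ 2 * algebraMap R A W.a₂ + C.r ^ 3
        - C.u ^ 6 * algebraMap R A W'.a₆,
      -(algebraMap R A W.a₃ + C.r * algebraMap R A W.a₁)] ?_ ?_
  · simp only [Fin.forall_fin_succ, Fin.forall_fin_zero]
    exact ⟨(((isIntegral_algebraMap.add (hr.mul isIntegral_algebraMap)).add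
        ((hr.pow 2).mul isIntegral_algebraMap)).add (hr.pow 3)).sub
        ((hu.pow 6).mul isIntegral_algebraMap),
      (isIntegral_algebraMap.add (hr.mul isIntegral_algebraMap)).neg, trivial⟩
  · simp only [Fin.sum_univ_two, Matrix.cons_val, Fin.coe_ofNat_eq_mod, Nat.reduceMod]
    linear_combination -ha₆

theorem exists_map_eq_of_isUnit_Δ [IsIntegrallyClosedIn R A]
    (hC : C • W.map (algebraMap R A) = W'.map (algebraMap R A))
    (hW : IsUnit W.Δ) (hW' : IsUnit W'.Δ) :
    ∃ C₀ : VariableChange R, C₀.map (algebraMap R A) = C := by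
  have hC' : C⁻¹ • W'.map (algebraMap R A) = W.map (algebraMap R A) := by
    rw [← hC, inv_smul_smul]
  have hu_int := isIntegral_u_of_isUnit_Δ hC hW'
  obtain ⟨u, hu⟩ := IsIntegrallyClosedIn.algebraMap_eq_of_integral hu_int
  obtain ⟨v, hv⟩ : ∃ v, algebraMap R A v = C.u⁻¹ :=
    IsIntegrallyClosedIn.algebraMap_eq_of_integral (isIntegral_u_of_isUnit_Δ hC' hW)
  obtain ⟨r, hr⟩ :=
    IsIntegrallyClosedIn.algebraMap_eq_of_integral (isIntegral_r_of_isIntegral_u hC hu_int)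
  obtain ⟨s, hs⟩ :=
    IsIntegrallyClosedIn.algebraMap_eq_of_integral (isIntegral_s_of_isIntegral_u hC hu_int)
  obtain ⟨t, ht⟩ :=
    IsIntegrallyClosedIn.algebraMap_eq_of_integral (isIntegral_t_of_isIntegral_u hC hu_int)
  have huv : u * v = 1 := IsIntegralClosure.algebraMap_injective R R A <| by
    rw [map_mul, hu, hv, map_one, Units.mul_inv]
  exact ⟨⟨.mkOfMulEqOne u v huv, r, s, t⟩, VariableChange.ext (Units.ext hu) hr hs ht⟩

theorem exists_smul_eq_of_isUnit_Δ [IsIntegrallyClosedIn R A]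
    (hC : C • W.map (algebraMap R A) = W'.map (algebraMap R A))
    (hW : IsUnit W.Δ) (hW' : IsUnit W'.Δ) : ∃ C₀ : VariableChange R, C₀ • W = W' := by
  obtain ⟨C₀, rfl⟩ := exists_map_eq_of_isUnit_Δ hC hW hW'
  rw [map_variableChange] at hC
  exact ⟨C₀, map_injective (IsIntegralClosure.algebraMap_injective R R A) hC⟩

end VariableChange

section AffineSolution

/-- The solutions `(x, y)` of the affine equation of a Weierstrass curve. Unlike the nonzero points
of Mathlib's `WeierstrassCurve.Affine.Point`, they may be singular. -/
abbrev AffineSolution {R : Type*} [CommRing R] (W : WeierstrassCurve R) : Type _ :=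
  {Q : R × R // W.toAffine.Equation Q.1 Q.2}

variable {R S : Type*} [CommRing R] [CommRing S]

theorem smul_equation_iff (W : WeierstrassCurve R) (C : VariableChange R) (x y : R) :
    (C • W).toAffine.Equation x y ↔
      W.toAffine.Equation (C.u ^ 2 * x + C.r) (C.u ^ 3 * y + C.u ^ 2 * C.s * x + C.t) := by
  have ha₁ := pow_mul_inv_pow_mul C.u 1 (W.a₁ + 2 * C.s)
  have ha₂ := pow_mul_inv_pow_mul C.u 2 (W.a₂ - C.s * W.a₁ + 3 * C.r - C.s ^ 2)
  have ha₃ := pow_mul_inv_pow_mul C.u 3 (W.a₃ + C.r * W.a₁ + 2 * C.t)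
  have ha₄ := pow_mul_inv_pow_mul C.u 4
    (W.a₄ - C.s * W.a₃ + 2 * C.r * W.a₂ - (C.t + C.r * C.s) * W.a₁ + 3 * C.r ^ 2 - 2 * C.s * C.t)
  have ha₆ := pow_mul_inv_pow_mul C.u 6
    (W.a₆ + C.r * W.a₄ + C.r ^ 2 * W.a₂ + C.r ^ 3 - C.t * W.a₃ - C.t ^ 2 - C.r * C.t * W.a₁)
  rw [Affine.equation_iff', Affine.equation_iff', ← ((C.u.isUnit).pow 6).mul_right_eq_zero]
  simp only [variableChange_def]
  refine Eq.congr_left ?_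
  linear_combination (C.u : R) ^ 5 * x * y * ha₁ + (C.u : R) ^ 3 * y * ha₃
    - (C.u : R) ^ 4 * x ^ 2 * ha₂ - (C.u : R) ^ 2 * x * ha₄ - ha₆

/-- The affine substitution `(x, y) ↦ (u²x + r, u³y + u²sx + t)`, which carries the solutions of
`C • W` to those of `W`. -/
def affineSolutionSMulEquiv (W : WeierstrassCurve R) (C : VariableChange R) :
    AffineSolution (C • W) ≃ AffineSolution W :=
  Equiv.subtypeEquiv
    { toFun := fun Q ↦ (C.u ^ 2 * Q.1 + C.r, C.u ^ 3 * Q.2 + C.u ^ 2 * C.s * Q.1 + C.t)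
      invFun := fun Q ↦ ((↑C.u⁻¹) ^ 2 * (Q.1 - C.r),
        (↑C.u⁻¹) ^ 3 * (Q.2 - C.s * (Q.1 - C.r) - C.t))
      left_inv := fun Q ↦ by
        ext
        · linear_combination inv_pow_mul_pow_mul C.u 2 Q.1
        · linear_combination inv_pow_mul_pow_mul C.u 3 Q.2
      right_inv := fun Q ↦ by
        ext
        · linear_combination pow_mul_inv_pow_mul C.u 2 (Q.1 - C.r)
        · linear_combination pow_mul_inv_pow_mul C.u 3 (Q.2 - C.s * (Q.1 - C.r) - C.t)
            + C.s * pow_mul_inv_pow_mul C.u 2 (Q.1 - C.r) }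
    fun Q ↦ smul_equation_iff W C Q.1 Q.2

/-- A ring isomorphism carries the solutions of a Weierstrass equation to those of its image. -/
def affineSolutionMapEquiv (W : WeierstrassCurve R) (e : R ≃+* S) :
    AffineSolution W ≃ AffineSolution (W.map (e : R →+* S)) :=
  Equiv.subtypeEquiv (e.toEquiv.prodCongr e.toEquiv) fun Q ↦
    (Affine.map_equation W (f := (e : R →+* S)) e.injective Q.1 Q.2).symm

theorem natCard_point_eq_natCard_affineSolution_add_one [Nontrivial R] [Finite R]
    (W : WeierstrassCurve R) [W.IsElliptic] :
    Nat.card W.toAffine.Point = Nat.card (AffineSolution W) + 1 := by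
  have e : W.toAffine.Point ≃ Option (AffineSolution W) :=
    { toFun := fun
        | .zero => none
        | .some x y h => some ⟨(x, y), h.1⟩
      invFun := fun
        | none => .zero
        | some Q => .some Q.1.1 Q.1.2 (Affine.equation_iff_nonsingular.mp Q.2)
      left_inv := by rintro (_ | _) <;> rfl
      right_inv := by rintro (_ | _) <;> rfl }
  rw [Nat.card_congr e, Finite.card_option]

theorem natCard_affineSolution_le [IsDomain R] [Finite R] (W : WeierstrassCurve R) :
    Nat.card (AffineSolution W) ≤ 2 * Nat.card R := by
  classical
  have := Fintype.ofFinite R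
  rw [Nat.card_eq_fintype_card, Nat.card_eq_fintype_card, ← Finset.card_univ]
  refine (Finset.card_le_mul_card_image (f := fun Q : AffineSolution W ↦ Q.1.1) _ 2 ?_).trans
    (Nat.mul_le_mul_left 2 (Finset.card_le_univ _))
  intro x _
  have hfib : ∀ Q ∈ Finset.univ.filter fun Q : AffineSolution W ↦ Q.1.1 = x,
      Q.1.2 ∈ (W.toAffine.polynomial.map (evalRingHom x)).roots.toFinset := by
    rintro ⟨⟨x', y⟩, hQ⟩ hx
    obtain rfl : x' = x := (Finset.mem_filter.mp hx).2
    rw [Multiset.mem_toFinset, mem_roots (Affine.monic_polynomial.map _).ne_zero, IsRoot.def,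
      eval_map, eval₂_evalRingHom]
    exact hQ
  have hinj : Set.InjOn (fun Q : AffineSolution W ↦ Q.1.2)
      (Finset.univ.filter fun Q : AffineSolution W ↦ Q.1.1 = x) := fun Q hQ Q' hQ' h ↦
    Subtype.ext <| Prod.ext
      ((Finset.mem_filter.mp hQ).2.trans (Finset.mem_filter.mp hQ').2.symm) h
  calc _ ≤ _ := Finset.card_le_card_of_injOn _ hfib hinj
    _ ≤ _ := Multiset.toFinset_card_le _
    _ ≤ _ := card_roots' _
    _ ≤ 2 := natDegree_map_le.trans_eq Affine.natDegree_polynomial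

end AffineSolution

section GoodReduction

open IsDiscreteValuationRing IsDedekindDomain.HeightOneSpectrum IsLocalRing

variable (R : Type*) [CommRing R] [IsDomain R] [IsDiscreteValuationRing R]
  {K : Type*} [Field K] [Algebra R K] [IsFractionRing R K]

theorem valuation_algebraMap_eq_one_iff_isUnit (x : R) :
    valuation K (maximalIdeal R) (algebraMap R K x) = 1 ↔ IsUnit x :=
  (valuation_eq_one_iff_notMem _).trans notMem_maximalIdeal

variable {R} {E : WeierstrassCurve K} [IsMinimal R E] {W : WeierstrassCurve R}
  {C : VariableChange K}

theorem hasGoodReduction_of_smul_eq_map (hC : C • E = W.map (algebraMap R K))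
    (hW : IsUnit W.Δ) : E.HasGoodReduction R := by
  have : (C • E).IsIntegral R := ⟨W, hC⟩
  -- Valuations of integral discriminants are at most `1`; that of `C • E` attains this bound.
  have hval : (valuation_Δ_aux R (C • E) : WithZero (Multiplicative ℤ)) = 1 := by
    rw [valuation_Δ_aux_eq_of_isIntegral, hC, map_Δ, valuation_algebraMap_eq_one_iff_isUnit]
    exact hW
  have hle : valuation_Δ_aux R (C • E) ≤ valuation_Δ_aux R E := by
    have hmax := (IsMinimal.val_Δ_maximal (R := R) (W := E)).2 (j := C) this
    simp only [one_smul] at hmax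
    exact hmax (Subtype.coe_le_coe.mp ((valuation_Δ_aux R E).2.trans_eq hval.symm))
  constructor
  rw [← valuation_Δ_aux_eq_of_isIntegral]
  exact le_antisymm (valuation_Δ_aux R E).2 (hval.symm.trans_le (Subtype.coe_le_coe.mpr hle))

theorem exists_smul_integralModel_eq (hC : C • E = W.map (algebraMap R K)) (hW : IsUnit W.Δ) :
    ∃ C₀ : VariableChange R, C₀ • integralModel R E = W := by
  have hgood := hasGoodReduction_of_smul_eq_map hC hW
  have hunit : IsUnit (integralModel R E).Δ := by
    rw [← valuation_algebraMap_eq_one_iff_isUnit R (K := K), integralModel_Δ_eq]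
    exact hgood.goodReduction
  have : IsIntegrallyClosedIn R K :=
    (isIntegrallyClosed_iff_isIntegrallyClosedIn K).mp inferInstance
  exact exists_smul_eq_of_isUnit_Δ (by rwa [← baseChange_integralModel_eq R E] at hC) hunit hW

theorem natCard_reduction_point [Finite (ResidueField R)]
    (hC : C • E = W.map (algebraMap R K)) (hW : IsUnit W.Δ) :
    Nat.card (E.reduction R).toAffine.Point =
      Nat.card (AffineSolution (W.map (residue R))) + 1 := by
  have hgood := hasGoodReduction_of_smul_eq_map hC hW
  have := (hasGoodReduction_iff_isElliptic_reduction R).mp hgood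
  obtain ⟨C₀, rfl⟩ := exists_smul_integralModel_eq hC hW
  rw [natCard_point_eq_natCard_affineSolution_add_one, ← map_variableChange,
    Nat.card_congr (affineSolutionSMulEquiv _ _)]
  rfl

theorem localPolynomial_map_of_isUnit_Δ [Finite (ResidueField R)] (hW : IsUnit W.Δ) :
    (W.map (algebraMap R K)).localPolynomial R =
      1 - Polynomial.C ((Nat.card (ResidueField R) : ℤ) + 1 -
        (Nat.card (AffineSolution (W.map (residue R))) + 1)) * X +
        Polynomial.C (Nat.card (ResidueField R) : ℤ) * X ^ 2 := by
  set E := (W.map (algebraMap R K)).minimal R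
  obtain ⟨C, hC⟩ : ∃ C : VariableChange K, C • E = W.map (algebraMap R K) :=
    ⟨_, inv_smul_smul ((W.map (algebraMap R K)).exists_isMinimal R).choose _⟩
  rw [localPolynomial, if_pos (hasGoodReduction_of_smul_eq_map hC hW),
    natCard_reduction_point hC hW, Nat.cast_succ]

end GoodReduction

section Padic

variable {p : ℕ} [Fact p.Prime] {W : WeierstrassCurve ℤ}

theorem localPolynomial_padic_of_isCoprime_Δ (hW : IsCoprime W.Δ p) :
    (W.map (Int.castRingHom ℚ_[p])).localPolynomial ℤ_[p] =
      1 - C ((p : ℤ) + 1 - (Nat.card (AffineSolution (W.map (Int.castRingHom (ZMod p)))) + 1)) * X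
        + C (p : ℤ) * X ^ 2 := by
  have hΔ : IsUnit (W.map (Int.castRingHom ℤ_[p])).Δ := by
    rw [map_Δ, eq_intCast, PadicInt.isUnit_iff, PadicInt.norm_intCast_eq_one_iff]
    exact hW
  let e : IsLocalRing.ResidueField ℤ_[p] ≃+* ZMod p := PadicInt.residueField
  have : Finite (IsLocalRing.ResidueField ℤ_[p]) := .of_equiv _ e.symm.toEquiv
  have hq : Nat.card (IsLocalRing.ResidueField ℤ_[p]) = p :=
    (Nat.card_congr e.toEquiv).trans (Nat.card_zmod p)
  have hcard : Nat.card
      (AffineSolution ((W.map (Int.castRingHom ℤ_[p])).map (IsLocalRing.residue ℤ_[p]))) =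
      Nat.card (AffineSolution (W.map (Int.castRingHom (ZMod p)))) := by
    rw [Nat.card_congr (affineSolutionMapEquiv _ e), WeierstrassCurve.map_map,
      WeierstrassCurve.map_map,
      RingHom.ext_int (RingHom.comp _ _) (Int.castRingHom (ZMod p))]
  have hmap : W.map (Int.castRingHom ℚ_[p]) =
      (W.map (Int.castRingHom ℤ_[p])).map (algebraMap ℤ_[p] ℚ_[p]) := by
    rw [WeierstrassCurve.map_map, RingHom.ext_int (RingHom.comp _ _) (Int.castRingHom ℚ_[p])]
  rw [hmap, localPolynomial_map_of_isUnit_Δ hΔ, hq, hcard]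

theorem a_eq (p : ℕ) :
    a p = p + 1 - (Nat.card (AffineSolution (E0.map (Int.castRingHom (ZMod p)))) + 1) :=
  rfl

theorem E0_Δ : E0.Δ = -2 ^ 15 := by
  norm_num [E0, WeierstrassCurve.Δ, b₂, b₄, b₆, b₈]

theorem localPoly_eq (hp : p ≠ 2) :
    localPoly p = 1 - C (a p : ℂ) * X + C (p : ℂ) * X ^ 2 := by
  have hΔ : IsCoprime E0.Δ p := by
    rw [E0_Δ, IsCoprime.neg_left_iff]
    exact .pow_left <| Nat.isCoprime_iff_coprime.mpr <|
      (Nat.coprime_primes Nat.prime_two Fact.out).mpr hp.symm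
  rw [localPoly, localPolynomial_padic_of_isCoprime_Δ hΔ, ← a_eq]
  simp

end Padic

section TraceBound

variable (p : ℕ) [Fact p.Prime]

theorem abs_a_le : |a p| ≤ p := by
  have h := natCard_affineSolution_le (E0.map (Int.castRingHom (ZMod p)))
  rw [Nat.card_zmod] at h
  rw [a_eq, abs_le]
  omega

theorem cast_prime_pos : (0 : ℝ) < p :=
  Nat.cast_pos.mpr (NeZero.pos p)

theorem sq_a_lt_disc : (a p : ℝ) ^ 2 < disc p := by
  have ha : (a p : ℝ) ^ 2 ≤ (p : ℝ) ^ 2 := mod_cast sq_le_sq' (abs_le.mp (abs_a_le p)).1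
    (abs_le.mp (abs_a_le p)).2
  have := cast_prime_pos p
  rw [disc]
  nlinarith

theorem disc_pos : 0 < disc p :=
  (sq_nonneg _).trans_lt (sq_a_lt_disc p)

theorem abs_a_lt_sqrt_disc : |(a p : ℝ)| < √(disc p) :=
  Real.lt_sqrt_of_sq_lt ((sq_abs _).trans_lt (sq_a_lt_disc p))

theorem wPlus_pos : 0 < wPlus p :=
  div_pos (by linarith [(abs_lt.mp (abs_a_lt_sqrt_disc p)).1]) (by linarith [cast_prime_pos p])

theorem wMinus_neg : wMinus p < 0 :=
  div_neg_of_neg_of_pos (by linarith [(abs_lt.mp (abs_a_lt_sqrt_disc p)).2])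
    (by linarith [cast_prime_pos p])

end TraceBound

section Matrix

variable {R : Type*} [CommRing R]

theorem charpolyRev_fin_two (M : Matrix (Fin 2) (Fin 2) R) :
    M.charpolyRev = 1 - C M.trace * X + C M.det * X ^ 2 := by
  simp only [Matrix.charpolyRev, Matrix.det_fin_two, Matrix.trace_fin_two, Matrix.sub_apply,
    Matrix.smul_apply, Matrix.map_apply, smul_eq_mul, Matrix.one_apply_eq, ne_eq, zero_ne_one,
    one_ne_zero, not_false_eq_true, Matrix.one_apply_ne, map_add, map_sub, map_mul]
  ring

theorem eval_charpolyRev {n : Type*} [Fintype n] [DecidableEq n] (M : Matrix n n R) (t : R) :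
    M.charpolyRev.eval t = (1 - t • M).det := by
  rw [Matrix.charpolyRev, ← coe_evalRingHom, RingHom.map_det]
  congr 1
  ext i j
  simp [Matrix.one_apply, apply_ite, mul_comm t]

theorem trace_inv_fin_two (M : Matrix (Fin 2) (Fin 2) R) :
    M⁻¹.trace = Ring.inverse M.det * M.trace := by
  rw [Matrix.inv_def, Matrix.trace_smul, smul_eq_mul, Matrix.adjugate_fin_two,
    Matrix.trace_fin_two_of, Matrix.trace_fin_two, add_comm]

theorem isUnit_det_and_trace_inv_and_det_inv_iff {K : Type*} [Field K]
    {M : Matrix (Fin 2) (Fin 2) K} {t q : K} (hq : q ≠ 0) :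
    (IsUnit M.det ∧ M⁻¹.trace = t ∧ M⁻¹.det = q) ↔ (M.trace = t / q ∧ M.det = q⁻¹) := by
  rw [trace_inv_fin_two, Matrix.det_nonsing_inv, Ring.inverse_eq_inv', isUnit_iff_ne_zero]
  constructor
  · rintro ⟨-, rfl, rfl⟩
    exact ⟨(mul_div_cancel_left₀ _ hq).symm, (inv_inv _).symm⟩
  · rintro ⟨ht, hd⟩
    simp [ht, hd, hq, mul_div_cancel₀]

end Matrix

section Matching

theorem pencilU_eq (u l : ℂ) :
    pencilU u l = !![u ^ 2 - 1 - l * u⁻¹, -(l * u⁻¹); l * u⁻¹, u ^ 2 + 1 - l * u⁻¹] := by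
  ext i j
  fin_cases i <;> fin_cases j <;> simp [pencilU, LS, V]

theorem trace_pencilU (u l : ℂ) : (pencilU u l).trace = 2 * (u ^ 2 - l * u⁻¹) := by
  rw [pencilU_eq, Matrix.trace_fin_two_of]
  ring

theorem det_pencilU (u l : ℂ) :
    (pencilU u l).det = (u ^ 2 - l * u⁻¹) ^ 2 + (l * u⁻¹) ^ 2 - 1 := by
  rw [pencilU_eq, Matrix.det_fin_two_of]
  ring

theorem trace_det_pencilU_iff {u l t q : ℂ} (hu : u ≠ 0) (hq : q ≠ 0) :
    ((pencilU u l).trace = t / q ∧ (pencilU u l).det = q⁻¹) ↔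
      (q * (u ^ 2 * u ^ 2) + -t * u ^ 2 + (t ^ 2 / (2 * q) - q - 1) = 0 ∧
        l = u * (u ^ 2 - t / (2 * q))) := by
  have htrace : (pencilU u l).trace = t / q ↔ l = u * (u ^ 2 - t / (2 * q)) := by
    rw [trace_pencilU]
    field_simp
    grind
  rw [htrace, and_comm]
  refine and_congr_left fun hl ↦ ?_
  rw [det_pencilU, hl]
  field_simp
  grind

variable {p : ℕ} [Fact p.Prime]

theorem quadratic_eq_zero_iff_eq_wPlus_or_eq_wMinus (z : ℂ) :
    p * (z * z) + -(a p : ℂ) * z + ((a p : ℂ) ^ 2 / (2 * p) - p - 1) = 0 ↔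
      z = wPlus p ∨ z = wMinus p := by
  have hp : (p : ℂ) ≠ 0 := NeZero.ne _
  have hsq : ((√(disc p) : ℝ) : ℂ) * (√(disc p) : ℝ) = 4 * p * (p + 1) - (a p : ℂ) ^ 2 := by
    rw [← Complex.ofReal_mul, Real.mul_self_sqrt (disc_pos p).le, disc]
    push_cast
    rfl
  have hdiscrim : discrim (p : ℂ) (-(a p : ℂ)) ((a p : ℂ) ^ 2 / (2 * p) - p - 1) =
      (√(disc p) : ℝ) * (√(disc p) : ℝ) := by
    rw [hsq, discrim]
    field_simp
    ring
  rw [quadratic_eq_zero_iff hp hdiscrim, wPlus, wMinus]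
  push_cast
  rw [neg_neg]

theorem isBasepoint_iff {x : ℂ × ℂ} :
    IsBasepoint p x ↔ x.1 ≠ 0 ∧ (x.1 ^ 2 = wPlus p ∨ x.1 ^ 2 = wMinus p) ∧
      x.2 = x.1 * (x.1 ^ 2 - (a p : ℂ) / (2 * p)) := by
  refine and_congr_right fun hu ↦ ?_
  rw [resolventU, isUnit_det_and_trace_inv_and_det_inv_iff (NeZero.ne _),
    trace_det_pencilU_iff hu (NeZero.ne _), quadratic_eq_zero_iff_eq_wPlus_or_eq_wMinus]

theorem IsBasepoint.P_eq_sq_div {x : ℂ × ℂ} (hx : IsBasepoint p x) :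
    P x.1 x.2 = x.1 ^ 2 / p := by
  rw [P_eq _ _ hx.1,
    ((isUnit_det_and_trace_inv_and_det_inv_iff (NeZero.ne _)).mp hx.2).2, div_eq_mul_inv]

end Matching

section SquareRoots

theorem sq_cpow_half (w : ℂ) : (w ^ (1 / 2 : ℂ)) ^ 2 = w := by
  rw [one_div, Complex.cpow_ofNat_inv_pow]

theorem cpow_half_ofReal_of_nonneg {w : ℝ} (hw : 0 ≤ w) :
    (w : ℂ) ^ (1 / 2 : ℂ) = (√w : ℝ) := by
  rw [Real.sqrt_eq_rpow, Complex.ofReal_cpow hw]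
  norm_num

theorem sq_eq_iff_eq_cpow_half_or_eq_neg {z w : ℂ} :
    z ^ 2 = w ↔ z = w ^ (1 / 2 : ℂ) ∨ z = -w ^ (1 / 2 : ℂ) := by
  rw [← sq_eq_sq_iff_eq_or_eq_neg, sq_cpow_half]

theorem im_eq_zero_iff_nonneg_of_sq_eq_ofReal {z : ℂ} {w : ℝ} (h : z ^ 2 = w) :
    z.im = 0 ↔ 0 ≤ w := by
  constructor
  · intro hz
    lift z to ℝ using hz
    exact (sq_nonneg z).trans_eq (mod_cast h)
  · intro hw
    rw [sq_eq_iff_eq_cpow_half_or_eq_neg, cpow_half_ofReal_of_nonneg hw] at h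
    obtain rfl | rfl := h <;> simp

end SquareRoots

section Basepoints

variable {p : ℕ}

theorem lam_eq {w : ℂ} (hw : w ≠ 0) :
    lam p w = w ^ (1 / 2 : ℂ) * (w - (a p : ℂ) / (2 * p)) := by
  rw [lam, show (3 / 2 : ℂ) = 1 + 1 / 2 by norm_num, Complex.cpow_add _ _ hw, Complex.cpow_one]
  ring

variable [Fact p.Prime]

theorem isBasepoint_and_sq_eq_iff {w : ℝ} (hw : w = wPlus p ∨ w = wMinus p) {x : ℂ × ℂ} :
    (IsBasepoint p x ∧ x.1 ^ 2 = w) ↔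
      x = ((w : ℂ) ^ (1 / 2 : ℂ), lam p w) ∨ x = (-(w : ℂ) ^ (1 / 2 : ℂ), -lam p w) := by
  obtain ⟨u, l⟩ := x
  have hw₀ : (w : ℂ) ≠ 0 := by
    rw [Complex.ofReal_ne_zero]
    obtain rfl | rfl := hw
    exacts [(wPlus_pos p).ne', (wMinus_neg p).ne]
  have hw' : (w : ℂ) = wPlus p ∨ (w : ℂ) = wMinus p := mod_cast hw
  have hbase : (IsBasepoint p (u, l) ∧ u ^ 2 = w) ↔
      (u ^ 2 = w ∧ l = u * (w - (a p : ℂ) / (2 * p))) := by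
    rw [and_comm, isBasepoint_iff]
    refine and_congr_right fun hu ↦ ?_
    have hu₀ : u ≠ 0 := by
      rintro rfl
      exact hw₀ (by rw [← hu, zero_pow two_ne_zero])
    simp only [hu, hw', hu₀, ne_eq, not_false_eq_true, true_and]
  rw [hbase, sq_eq_iff_eq_cpow_half_or_eq_neg, lam_eq hw₀, or_and_right, Prod.mk.injEq,
    Prod.mk.injEq, ← neg_mul]
  exact or_congr (and_congr_right fun hu ↦ by rw [hu]) (and_congr_right fun hu ↦ by rw [hu])

theorem not_isRealPoint_of_sq_eq_wMinus {x : ℂ × ℂ} (hx : x.1 ^ 2 = wMinus p) :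
    ¬ IsRealPoint x :=
  fun hr ↦ (wMinus_neg p).not_ge ((im_eq_zero_iff_nonneg_of_sq_eq_ofReal hx).mp hr.1)

theorem IsBasepoint.isRealPoint_iff {x : ℂ × ℂ} (hx : IsBasepoint p x) :
    IsRealPoint x ↔ x.1 ^ 2 = wPlus p := by
  obtain ⟨u, l⟩ := x
  obtain ⟨-, hu, hl⟩ := isBasepoint_iff.mp hx
  dsimp only at hu hl ⊢
  subst hl
  refine ⟨fun hr ↦ hu.resolve_right fun h ↦ not_isRealPoint_of_sq_eq_wMinus h hr, fun hu ↦ ?_⟩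
  have him : u.im = 0 := (im_eq_zero_iff_nonneg_of_sq_eq_ofReal hu).mpr (wPlus_pos p).le
  lift u to ℝ using him
  have hl : (u : ℂ) * ((u : ℂ) ^ 2 - (a p : ℂ) / (2 * p)) =
      (u * (u ^ 2 - (a p : ℝ) / (2 * p)) : ℝ) := by push_cast; rfl
  exact ⟨Complex.ofReal_im u, hl ▸ Complex.ofReal_im _⟩

theorem isBasepoint_and_isRealPoint_iff {x : ℂ × ℂ} :
    (IsBasepoint p x ∧ IsRealPoint x) ↔
      x = (((√(wPlus p) : ℝ) : ℂ), lam p (wPlus p)) ∨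
      x = (-((√(wPlus p) : ℝ) : ℂ), -lam p (wPlus p)) := by
  rw [and_congr_right fun hx : IsBasepoint p x ↦ hx.isRealPoint_iff,
    isBasepoint_and_sq_eq_iff (.inl rfl), cpow_half_ofReal_of_nonneg (wPlus_pos p).le]

theorem P_eq_wPlus_div {u l : ℂ} (hx : IsBasepoint p (u, l) ∧ IsRealPoint (u, l)) :
    P u l = (wPlus p / p : ℝ) := by
  rw [hx.1.P_eq_sq_div, hx.1.isRealPoint_iff.mp hx.2, Complex.ofReal_div, Complex.ofReal_natCast]

end Basepoints

section EulerFactor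

theorem pencil_eq_pencilU (w l : ℂ) : pencil w l = pencilU (w ^ (1 / 2 : ℂ)) l := by
  rw [pencil, pencilU, sq_cpow_half, Complex.cpow_neg]

variable {p : ℕ} [Fact p.Prime] {w : ℝ}

theorem isBasepoint_cpow_half (hw : w = wPlus p ∨ w = wMinus p) :
    IsBasepoint p ((w : ℂ) ^ (1 / 2 : ℂ), lam p w) :=
  ((isBasepoint_and_sq_eq_iff hw).mpr (.inl rfl)).1

theorem isUnit_det_pencil (hw : w = wPlus p ∨ w = wMinus p) :
    IsUnit (pencil w (lam p w)).det := by
  rw [pencil_eq_pencilU]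
  exact (isBasepoint_cpow_half hw).2.1

theorem charpolyRev_resolvent (hw : w = wPlus p ∨ w = wMinus p) :
    (resolvent w (lam p w)).charpolyRev = 1 - C (a p : ℂ) * X + C (p : ℂ) * X ^ 2 := by
  obtain ⟨-, -, htrace, hdet⟩ := isBasepoint_cpow_half hw
  rw [EulerMatching.resolvent, pencil_eq_pencilU, ← resolventU, charpolyRev_fin_two, htrace, hdet]

theorem det_one_sub_smul_resolvent (hw : w = wPlus p ∨ w = wMinus p) (s : ℂ) :
    (1 - (p : ℂ) ^ (-s) • resolvent w (lam p w)).det =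
      1 - (a p : ℂ) * (p : ℂ) ^ (-s) + (p : ℂ) ^ (1 - 2 * s) := by
  have hpow : (p : ℂ) ^ (1 - 2 * s) = p * ((p : ℂ) ^ (-s)) ^ 2 := by
    rw [← Complex.cpow_nat_mul, sub_eq_add_neg, Complex.cpow_add _ _ (NeZero.ne _),
      Complex.cpow_one, Nat.cast_ofNat, mul_neg]
  rw [← eval_charpolyRev, charpolyRev_resolvent hw, hpow]
  simp

theorem charpolyRev_resolvent_eq_localPoly (hp : p ≠ 2) (hw : w = wPlus p ∨ w = wMinus p) :
    (resolvent w (lam p w)).charpolyRev = localPoly p :=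
  (charpolyRev_resolvent hw).trans (localPoly_eq hp).symm

theorem det_one_sub_smul_resolvent_eq_inv_localLFactor (hp : p ≠ 2)
    (hw : w = wPlus p ∨ w = wMinus p) (s : ℂ) :
    (1 - (p : ℂ) ^ (-s) • resolvent w (lam p w)).det = (localLFactor p s)⁻¹ := by
  rw [← eval_charpolyRev, charpolyRev_resolvent_eq_localPoly hp hw, localLFactor, inv_inv]

end EulerFactor

end EulerMatching

open EulerMatching in
theorem mainTheorem2 (p : ℕ) [Fact p.Prime] :
    -- (a)
    0 < disc p ∧
    -- (b)
    (0 < wPlus p ∧ wMinus p < 0 ∧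
      {x : ℂ × ℂ | IsBasepoint p x ∧ IsRealPoint x} =
        {(((√(wPlus p) : ℝ) : ℂ), lam p (wPlus p)), (-((√(wPlus p) : ℝ) : ℂ), -lam p (wPlus p))} ∧
      {x : ℂ × ℂ | IsBasepoint p x ∧ x.1 ^ 2 = (wMinus p : ℂ)} =
        {((wMinus p : ℂ) ^ (1 / 2 : ℂ), lam p (wMinus p)),
          (-(wMinus p : ℂ) ^ (1 / 2 : ℂ), -lam p (wMinus p))} ∧
      (∀ x : ℂ × ℂ, IsBasepoint p x → x.1 ^ 2 = (wMinus p : ℂ) → ¬ IsRealPoint x) ∧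
      (∀ x : ℂ × ℂ, IsBasepoint p x → IsRealPoint x → P x.1 x.2 ≠ 0) ∧
      P ((√(wPlus p) : ℝ) : ℂ) (lam p (wPlus p)) = ((wPlus p / p : ℝ) : ℂ) ∧
      P (-((√(wPlus p) : ℝ) : ℂ)) (-lam p (wPlus p)) = ((wPlus p / p : ℝ) : ℂ)) ∧
    -- (c), for both branches
    (p ≠ 2 → ∀ w : ℝ, w = wPlus p ∨ w = wMinus p →
      IsUnit (pencil w (lam p w)).det ∧
      (resolvent w (lam p w)).charpolyRev =
        1 - Polynomial.C (a p : ℂ) * Polynomial.X + Polynomial.C (p : ℂ) * Polynomial.X ^ 2 ∧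
      (resolvent w (lam p w)).charpolyRev = localPoly p ∧
      ∀ s : ℂ,
        (1 - ((p : ℂ) ^ (-s)) • resolvent w (lam p w)).det =
            1 - (a p : ℂ) * (p : ℂ) ^ (-s) + (p : ℂ) ^ (1 - 2 * s) ∧
        (1 - ((p : ℂ) ^ (-s)) • resolvent w (lam p w)).det = (localLFactor p s)⁻¹) := by
  have hpos := (isBasepoint_and_isRealPoint_iff (p := p)).mpr (.inl rfl)
  have hneg := (isBasepoint_and_isRealPoint_iff (p := p)).mpr (.inr rfl)
  refine ⟨disc_pos p, ⟨wPlus_pos p, wMinus_neg p, Set.ext fun _ ↦ isBasepoint_and_isRealPoint_iff,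
    Set.ext fun _ ↦ isBasepoint_and_sq_eq_iff (.inr rfl),
    fun _ _ ↦ not_isRealPoint_of_sq_eq_wMinus, fun x hx hr ↦ ?_,
    P_eq_wPlus_div hpos, P_eq_wPlus_div hneg⟩, fun hp w hw ↦ ?_⟩
  · rw [P_eq_wPlus_div ⟨hx, hr⟩, Complex.ofReal_ne_zero]
    exact (div_pos (wPlus_pos p) (cast_prime_pos p)).ne'
  · refine ⟨isUnit_det_pencil hw, charpolyRev_resolvent hw,
      charpolyRev_resolvent_eq_localPoly hp hw, fun s ↦ ⟨?_, ?_⟩⟩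
    · exact det_one_sub_smul_resolvent hw s
    · exact det_one_sub_smul_resolvent_eq_inv_localLFactor hp hw s
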